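/- **Definitions.** Identify the plane with $\mathbb{C}=\mathbb{R}^2$ and let $\sigma\subseteq\mathbb{C}$ be nonempty and compact. For a finite list $S=[x_0,\dots,x_n]$ of (not necessarily distinct) points of $\sigma$ and $f:\sigma\to\mathbb{C}$ put $\operatorname{cvar}(f,S)=\sum_{i=1}^n|f(x_i)-f(x_{i-1})|$. For a line $\ell$ and $0\le i<n$, the segment $\overline{x_ix_{i+1}}$ is a *crossing segment* of $S$ on $\ell$ if (i) $x_i$ and $x_{i+1}$ lie strictly on opposite sides of $\ell$, or (ii) $i=0$ and $x_0\in\ell$, or (iii) $i>0$, $x_i\in\ell$ and $x_{i-1}\notin\ell$. Let $\operatorname{vf}(S)$ be the maximum over all lines $\ell$ of the number of crossing segments of $S$ on $\ell$ (and $\operatorname{vf}(S)=1$ if $n=0$). Let $\operatorname{var}(f,\sigma)=\sup_S \operatorname{cvar}(f,S)/\operatorname{vf}(S)$ and $\|f\|_{BV(\sigma)}=\sup_\sigma|f|+\operatorname{var}(f,\sigma)$. Then $BV(\sigma)=\{f:\|f\|_{BV(\sigma)}<\infty\}$, under pointwise operations, and $AC(\sigma)$ is the closure in $BV(\sigma)$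 of the restrictions to $\sigma$ of complex polynomials $\sum_{n,m}c_{nm}x^ny^m$ in the two real coordinates. Write $AC(\sigma)\simeq AC(\tau)$ if there is a linear and multiplicative bijection $\Phi:AC(\sigma)\to AC(\tau)$ such that $\Phi$ and $\Phi^{-1}$ are continuous for the $BV$ norms. Let $\mathrm{LG}$ be the class of compact connected subsets of the plane that are the union of finitely many compact line segments. **Example.** Let $\sigma=\{(t,0):0\le t\le 1\}$ and $\tau=\{(0,0)\}\cup\{(t,t\sin\frac1t):0<t\le 1\}$. Then $\sigma\in\mathrm{LG}$, and $\sigma$ and $\tau$ are homeomorphic, but $AC(\sigma)\not\simeq AC(\tau)$. Consequently the equivalence "$AC(\sigma')\simeq AC(\tau')$ if and only if $\sigma'$ is homeomorphic to $\tau'$" does not hold for all pairs $\sigma',\tau'$ of subsets of the plane each of which is homeomorphic to a set in $\mathrm{LG}$. -/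

import Mathlib

noncomputable section

open scoped ENNReal

namespace PlaneAC

/-! Variation of a function on a subset of the plane `ℂ = ℝ²` -/

/-- The line `{(x, y) : a x + b y = c}`, with `(a, b) ≠ (0, 0)`. -/
structure Line where
  a : ℝ
  b : ℝ
  c : ℝ
  ne_zero : a ≠ 0 ∨ b ≠ 0

/-- `ℓ.side z` vanishes exactly on the line; its sign tells the two open sides apart. -/
def Line.side (l : Line) (z : ℂ) : ℝ := l.a * z.re + l.b * z.im - l.c

/-- The segment from `x i` to `x (i + 1)` is a crossing segment of the list `x` on the line `l`. -/
def IsCrossing (l : Line) (x : ℕ → ℂ) (i : ℕ) : Prop :=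
  l.side (x i) * l.side (x (i + 1)) < 0 ∨
  (i = 0 ∧ l.side (x i) = 0) ∨
  (0 < i ∧ l.side (x i) = 0 ∧ l.side (x (i - 1)) ≠ 0)

open Classical in
/-- The number of crossing segments of the list `[x 0, …, x n]` on the line `l`. -/
def vfLine (x : ℕ → ℂ) (n : ℕ) (l : Line) : ℕ :=
  ((Finset.range n).filter (fun i => IsCrossing l x i)).card

/-- The variation factor of the list `[x 0, …, x n]`: the maximum over all lines of the number
of crossing segments (these numbers are at most `n`), and `1` for a one-point list. -/
def vf (x : ℕ → ℂ) (n : ℕ) : ℕ :=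
  if n = 0 then 1 else sSup (Set.range (vfLine x n))

/-- The curve variation of `f` on the list `[x 0, …, x n]`. -/
def cvar {σ : Set ℂ} (f : σ → ℂ) (x : ℕ → σ) (n : ℕ) : ℝ≥0∞ :=
  ∑ i ∈ Finset.range n, ‖f (x (i + 1)) - f (x i)‖ₑ

/-- The two-dimensional variation of `f` on `σ`; the finite lists of elements of `σ` are the
initial pieces `[x 0, …, x n]` of sequences in `σ`. -/
def variation {σ : Set ℂ} (f : σ → ℂ) : ℝ≥0∞ :=
  ⨆ (n : ℕ) (x : ℕ → σ), cvar f x n / (vf (fun i => (x i : ℂ)) n : ℝ≥0∞)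

/-- The supremum norm, with values in `[0, ∞]`. -/
def supENorm {σ : Set ℂ} (f : σ → ℂ) : ℝ≥0∞ := ⨆ z, ‖f z‖ₑ

/-- The variation norm, with values in `[0, ∞]`. -/
def bvENorm {σ : Set ℂ} (f : σ → ℂ) : ℝ≥0∞ := supENorm f + variation f

/-! Facts needed to see that the functions of bounded variation form a normed algebra -/

section Facts

variable {σ : Set ℂ}

theorem enorm_le_supENorm (f : σ → ℂ) (z : σ) : ‖f z‖ₑ ≤ supENorm f :=
  le_iSup (fun z => ‖f z‖ₑ) z

theorem cvar_div_le (f : σ → ℂ) (x : ℕ → σ) (n : ℕ) :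
    cvar f x n / (vf (fun i => (x i : ℂ)) n : ℝ≥0∞) ≤ variation f :=
  le_iSup₂ (f := fun (n : ℕ) (x : ℕ → σ) =>
    cvar f x n / (vf (fun i => (x i : ℂ)) n : ℝ≥0∞)) n x

theorem variation_const (c : ℂ) : variation (fun _ : σ => c) = 0 := by
  simp [variation, cvar]

theorem supENorm_const_le (c : ℂ) : supENorm (fun _ : σ => c) ≤ ‖c‖ₑ :=
  iSup_le fun _ => le_rfl

theorem bvENorm_const_lt_top (c : ℂ) : bvENorm (fun _ : σ => c) < ∞ := by
  rw [bvENorm, variation_const, add_zero]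
  exact (supENorm_const_le c).trans_lt enorm_lt_top

theorem supENorm_add_le (f g : σ → ℂ) : supENorm (f + g) ≤ supENorm f + supENorm g :=
  iSup_le fun z => (enorm_add_le _ _).trans
    (add_le_add (enorm_le_supENorm f z) (enorm_le_supENorm g z))

theorem supENorm_mul_le (f g : σ → ℂ) : supENorm (f * g) ≤ supENorm f * supENorm g :=
  iSup_le fun z => by
    rw [Pi.mul_apply, enorm_mul]
    exact mul_le_mul' (enorm_le_supENorm f z) (enorm_le_supENorm g z)

theorem variation_add_le (f g : σ → ℂ) : variation (f + g) ≤ variation f + variation g := by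
  refine iSup₂_le fun n x => le_trans ?_ (add_le_add (cvar_div_le f x n) (cvar_div_le g x n))
  rw [← ENNReal.add_div]
  refine ENNReal.div_le_div_right ?_ _
  rw [cvar, cvar, cvar, ← Finset.sum_add_distrib]
  refine Finset.sum_le_sum fun i _ => ?_
  have h : (f + g) (x (i + 1)) - (f + g) (x i) =
      (f (x (i + 1)) - f (x i)) + (g (x (i + 1)) - g (x i)) := by
    simp only [Pi.add_apply]; ring
  rw [h]
  exact enorm_add_le _ _

theorem variation_mul_le (f g : σ → ℂ) :
    variation (f * g) ≤ supENorm f * variation g + supENorm g * variation f := by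
  refine iSup₂_le fun n x => le_trans ?_
    (add_le_add (mul_le_mul_right (cvar_div_le g x n) (supENorm f))
      (mul_le_mul_right (cvar_div_le f x n) (supENorm g)))
  rw [← mul_div_assoc, ← mul_div_assoc, ← ENNReal.add_div]
  refine ENNReal.div_le_div_right ?_ _
  rw [cvar, cvar, cvar, Finset.mul_sum, Finset.mul_sum, ← Finset.sum_add_distrib]
  refine Finset.sum_le_sum fun i _ => ?_
  have h : (f * g) (x (i + 1)) - (f * g) (x i) =
      f (x (i + 1)) * (g (x (i + 1)) - g (x i)) + g (x i) * (f (x (i + 1)) - f (x i)) := by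
    simp only [Pi.mul_apply]; ring
  rw [h]
  refine (enorm_add_le _ _).trans ?_
  rw [enorm_mul, enorm_mul]
  exact add_le_add (mul_le_mul_left (enorm_le_supENorm f _) _)
    (mul_le_mul_left (enorm_le_supENorm g _) _)

theorem bvENorm_add_le (f g : σ → ℂ) : bvENorm (f + g) ≤ bvENorm f + bvENorm g :=
  (add_le_add (supENorm_add_le f g) (variation_add_le f g)).trans_eq
    (add_add_add_comm _ _ _ _)

theorem bvENorm_mul_le (f g : σ → ℂ) : bvENorm (f * g) ≤ bvENorm f * bvENorm g := by
  refine (add_le_add (supENorm_mul_le f g) (variation_mul_le f g)).trans ?_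
  have h : bvENorm f * bvENorm g =
      supENorm f * supENorm g + (supENorm f * variation g + supENorm g * variation f) +
        variation f * variation g := by
    simp only [bvENorm]; ring
  rw [h]
  exact le_self_add

theorem bvENorm_neg (f : σ → ℂ) : bvENorm (-f) = bvENorm f := by
  have h : ∀ i j, -f i - -f j = -(f i - f j) := fun i j => by ring
  simp only [bvENorm, supENorm, variation, cvar, Pi.neg_apply, h, enorm_neg]

end Facts

/-! The Banach algebras of functions of bounded variation and of absolutely continuous
functions -/

/-- The functions of bounded variation, as an algebra of functions under pointwise operations. -/
def bvSubalgebra (σ : Set ℂ) : Subalgebra ℂ (σ → ℂ) where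
  carrier := {f | bvENorm f < ∞}
  mul_mem' {f g} hf hg := (bvENorm_mul_le f g).trans_lt (ENNReal.mul_lt_top hf hg)
  add_mem' {f g} hf hg := (bvENorm_add_le f g).trans_lt (ENNReal.add_lt_top.2 ⟨hf, hg⟩)
  algebraMap_mem' c := bvENorm_const_lt_top c

/-- The algebra `BV(σ)`. It is a type of its own so that its topology is that of the variation
norm and not that of pointwise convergence. -/
def BV (σ : Set ℂ) : Type := bvSubalgebra σ

instance (σ : Set ℂ) : CommRing (BV σ) := inferInstanceAs (CommRing (bvSubalgebra σ))

instance (σ : Set ℂ) : Algebra ℂ (BV σ) := inferInstanceAs (Algebra ℂ (bvSubalgebra σ))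

/-- The function underlying an element of `BV(σ)`. -/
def BV.toFun (σ : Set ℂ) : BV σ →ₐ[ℂ] (σ → ℂ) := (bvSubalgebra σ).val

theorem BV.toFun_injective (σ : Set ℂ) : Function.Injective (BV.toFun σ) :=
  Subtype.val_injective

theorem BV.bvENorm_ne_top {σ : Set ℂ} (f : BV σ) : bvENorm (BV.toFun σ f) ≠ ∞ :=
  (Subtype.property (p := fun g : σ → ℂ => g ∈ bvSubalgebra σ) f).ne

/-- The variation norm `‖f‖_∞ + var(f, σ)` on `BV(σ)`. -/
def BV.ringNorm (σ : Set ℂ) : RingNorm (BV σ) where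
  toFun f := (bvENorm (BV.toFun σ f)).toReal
  map_zero' := by
    simp [bvENorm, supENorm, variation, cvar]
  add_le' f g := by
    rw [map_add, ← ENNReal.toReal_add f.bvENorm_ne_top g.bvENorm_ne_top]
    exact ENNReal.toReal_mono (ENNReal.add_ne_top.2 ⟨f.bvENorm_ne_top, g.bvENorm_ne_top⟩)
      (bvENorm_add_le _ _)
  neg' f := by
    rw [map_neg, bvENorm_neg]
  mul_le' f g := by
    rw [map_mul, ← ENNReal.toReal_mul]
    exact ENNReal.toReal_mono (ENNReal.mul_ne_top f.bvENorm_ne_top g.bvENorm_ne_top)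
      (bvENorm_mul_le _ _)
  eq_zero_of_map_eq_zero' f hf := by
    have h0 : bvENorm (BV.toFun σ f) = 0 :=
      ((ENNReal.toReal_eq_zero_iff _).1 hf).resolve_right f.bvENorm_ne_top
    have h1 : supENorm (BV.toFun σ f) = 0 := (add_eq_zero.1 h0).1
    apply BV.toFun_injective σ
    rw [map_zero]
    funext z
    have h2 := enorm_le_supENorm (BV.toFun σ f) z
    rw [h1] at h2
    exact enorm_eq_zero.1 (le_antisymm h2 zero_le)

instance (σ : Set ℂ) : NormedCommRing (BV σ) :=
  { (BV.ringNorm σ).toNormedRing, (inferInstance : CommRing (BV σ)) with }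

theorem BV.norm_def {σ : Set ℂ} (f : BV σ) : ‖f‖ = (bvENorm (BV.toFun σ f)).toReal := rfl

instance (σ : Set ℂ) : NormedAlgebra ℂ (BV σ) where
  norm_smul_le c f := by
    have h : BV.toFun σ (c • f) = (fun _ => c) * BV.toFun σ f := by
      rw [map_smul]; rfl
    rw [BV.norm_def, BV.norm_def, h, ← toReal_enorm c, ← ENNReal.toReal_mul]
    refine ENNReal.toReal_mono (ENNReal.mul_ne_top enorm_ne_top f.bvENorm_ne_top) ?_
    refine (bvENorm_mul_le _ _).trans (mul_le_mul_left ?_ _)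
    rw [bvENorm, variation_const, add_zero]
    exact supENorm_const_le c

/-- The restrictions to `σ` of the complex polynomials `∑ c_{nm} xⁿ yᵐ` in the two real
coordinates of the plane. -/
def polyFun (σ : Set ℂ) : Subalgebra ℂ (σ → ℂ) :=
  (MvPolynomial.aeval (R := ℂ)
    ![fun z : σ => ((z : ℂ).re : ℂ), fun z : σ => ((z : ℂ).im : ℂ)]).range

/-- The algebra `AC(σ)`: the closure in `BV(σ)`, for the variation norm, of the (restrictions to
`σ` of) polynomials in two real variables. On a compact set every polynomial function is of
bounded variation, so that the preimage below is all of `polyFun σ`. -/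
def AC (σ : Set ℂ) : Subalgebra ℂ (BV σ) :=
  ((polyFun σ).comap (BV.toFun σ)).topologicalClosure

/-- Isomorphism of `AC(σ)` and `AC(τ)` as Banach algebras: there is a linear and multiplicative
bijection that is continuous together with its inverse. -/
def ACIsomorphic (σ τ : Set ℂ) : Prop := Nonempty (AC σ ≃A[ℂ] AC τ)

/-- Linear graphs: compact connected subsets of the plane that are the union of finitely many
(compact, nondegenerate) line segments. -/
def IsLinearGraph (σ : Set ℂ) : Prop :=
  IsCompact σ ∧ IsConnected σ ∧
    ∃ (m : ℕ) (p q : Fin m → ℂ), (∀ j, p j ≠ q j) ∧ σ = ⋃ j, segment ℝ (p j) (q j)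

/-- The segment `{(t, 0) : 0 ≤ t ≤ 1}`. -/
def unitSegment : Set ℂ := {z | ∃ t : ℝ, 0 ≤ t ∧ t ≤ 1 ∧ z = ⟨t, 0⟩}

/-- The curve `{(0, 0)} ∪ {(t, t sin (1/t)) : 0 < t ≤ 1}`. -/
def sineCurve : Set ℂ :=
  {0} ∪ {z | ∃ t : ℝ, 0 < t ∧ t ≤ 1 ∧ z = ⟨t, t * Real.sin (1 / t)⟩}

end PlaneAC

end

noncomputable section

open scoped ENNReal

namespace PlaneAC

/-! Variation factors -/

/-! An isomorphism `Ψ` from the algebra of the segment to that of the curve pulls characters back to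
characters. On a compact set every continuous character of `AC` is a point evaluation
(`exists_eq_eval`), so `Ψ.symm` is composition with a map `h` from the segment to the curve. With `p
= Re ∘ h`, the coordinates `X`, `Y` of the curve go to `p` and `osc ∘ p`, both of which must have
finite variation.

The coordinate `Y` does lie in `BV` of the curve, despite the oscillation: by an integral over level
lines, the variation factor absorbs it (`variation_linear_le`). On the segment nothing absorbs it,
because monotone lists have variation factor at most one. Since `p` is continuous, nonnegative, zero
somewhere and positive somewhere, it attains infinitely many of the peaks of `osc` in monotone
order, and the resulting sum dominates a tail of the harmonic series (`variation_osc_comp_eq_top`).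
-/

theorem vfLine_le (x : ℕ → ℂ) (n : ℕ) (l : Line) : vfLine x n l ≤ n := by
  classical
  exact (Finset.card_filter_le _ _).trans_eq (Finset.card_range n)

theorem vfLine_le_vf (x : ℕ → ℂ) (n : ℕ) (l : Line) : vfLine x n l ≤ vf x n := by
  rcases Nat.eq_zero_or_pos n with rfl | hn
  · exact (vfLine_le x 0 l).trans (Nat.zero_le _)
  · rw [vf, if_neg hn.ne']
    exact le_csSup ⟨n, by rintro _ ⟨l, rfl⟩; exact vfLine_le x n l⟩ ⟨l, rfl⟩

/-- A list of points in strictly monotone position on a line has variation factor at most one. -/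
theorem vf_le_one_of_strictAnti (A B : ℂ) (r : ℕ → ℝ) (hr : StrictAnti r) (n : ℕ) :
    vf (fun i => A + (r i : ℂ) * B) n ≤ 1 := by
  classical
  rw [vf]
  split_ifs with hn
  · exact le_rfl
  refine csSup_le' ?_
  rintro _ ⟨l, rfl⟩
  have hside : ∀ i, l.side (A + (r i : ℂ) * B) =
      (l.a * A.re + l.b * A.im - l.c) + r i * (l.a * B.re + l.b * B.im) := by
    intro i
    simp only [Line.side, Complex.add_re, Complex.add_im, Complex.re_ofReal_mul,
      Complex.im_ofReal_mul]
    ring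
  rw [vfLine, Finset.card_le_one]
  simp only [Finset.mem_filter, IsCrossing, hside]
  generalize l.a * A.re + l.b * A.im - l.c = β
  generalize l.a * B.re + l.b * B.im = α
  -- The side function is affine along the list. If it is constant, only the segment at index 0 can
  -- cross. Otherwise it is strictly monotone, so a crossing at `i` leaves all points from `i + 1`
  -- on strictly on one side.
  have key : ∀ i j, i < j →
      ((β + r i * α) * (β + r (i + 1) * α) < 0 ∨ (i = 0 ∧ β + r i * α = 0) ∨
        (0 < i ∧ β + r i * α = 0 ∧ β + r (i - 1) * α ≠ 0)) →
      ((β + r j * α) * (β + r (j + 1) * α) < 0 ∨ (j = 0 ∧ β + r j * α = 0) ∨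
        (0 < j ∧ β + r j * α = 0 ∧ β + r (j - 1) * α ≠ 0)) → False := by
    intro i j hij hi hj
    rcases eq_or_ne α 0 with rfl | hα
    · simp only [mul_zero, add_zero] at hi hj
      rcases hj with h | h | h
      · nlinarith [mul_self_nonneg β]
      · omega
      · exact h.2.2 h.2.1
    have h1 : r (i + 1) < r i := hr (Nat.lt_succ_self i)
    have h2 : r (j + 1) < r j := hr (Nat.lt_succ_self j)
    have h3 : r j ≤ r (i + 1) := hr.antitone hij
    have hi' : (β + r i * α) * (β + r (i + 1) * α) ≤ 0 := by
      rcases hi with h | h | h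
      · exact h.le
      · rw [h.2, zero_mul]
      · rw [h.2.1, zero_mul]
    have hj' : (β + r j * α) * (β + r (j + 1) * α) ≤ 0 := by
      rcases hj with h | h | h
      · exact h.le
      · rw [h.2, zero_mul]
      · rw [h.2.1, zero_mul]
    have hi0 : β + r (i + 1) * α ≠ 0 := by
      intro h0
      rcases hi with h | h | h
      · rw [h0, mul_zero] at h; exact lt_irrefl _ h
      · have : (r i - r (i + 1)) * α = 0 := by linarith
        rcases mul_eq_zero.1 this with h' | h'
        · linarith
        · exact hα h'
      · have : (r i - r (i + 1)) * α = 0 := by linarith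
        rcases mul_eq_zero.1 this with h' | h'
        · linarith
        · exact hα h'
    rcases lt_or_gt_of_ne hα with hα | hα
    · have a1 : (r i - r (i+1)) * α < 0 := mul_neg_of_pos_of_neg (by linarith) hα
      have a2 : (r j - r (j+1)) * α < 0 := mul_neg_of_pos_of_neg (by linarith) hα
      have a3 : (r (i+1) - r j) * α ≤ 0 := mul_nonpos_of_nonneg_of_nonpos (by linarith) hα.le
      have p1 : 0 < β + r (i + 1) * α := by
        by_contra! h
        have h' := lt_of_le_of_ne h hi0
        nlinarith
      have : 0 < (β + r j * α) * (β + r (j + 1) * α) := mul_pos (by linarith) (by linarith)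
      linarith
    · have a1 : 0 < (r i - r (i+1)) * α := mul_pos (by linarith) hα
      have a2 : 0 < (r j - r (j+1)) * α := mul_pos (by linarith) hα
      have a3 : 0 ≤ (r (i+1) - r j) * α := mul_nonneg (by linarith) hα.le
      have p1 : β + r (i + 1) * α < 0 := by
        by_contra! h
        have h' := lt_of_le_of_ne h hi0.symm
        nlinarith
      have : 0 < (β + r j * α) * (β + r (j + 1) * α) :=
        mul_pos_of_neg_of_neg (by linarith) (by linarith)
      linarith
  intro i hi j hj
  rcases lt_trichotomy i j with h | h | h
  · exact (key i j h hi.2 hj.2).elim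
  · exact h
  · exact (key j i h hj.2 hi.2).elim

variable {σ : Set ℂ}

/-- Along a strictly monotone list of collinear points the curve variation is bounded by the
two-dimensional variation. -/
theorem cvar_le_variation_of_strictAnti (f : σ → ℂ) (x : ℕ → σ) (A B : ℂ) (r : ℕ → ℝ)
    (hr : StrictAnti r) (hx : ∀ i, (x i : ℂ) = A + (r i : ℂ) * B) (n : ℕ) :
    cvar f x n ≤ variation f := by
  have h := cvar_div_le f x n
  have h1 : vf (fun i => (x i : ℂ)) n ≤ 1 := by
    simp only [hx]
    exact vf_le_one_of_strictAnti A B r hr n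
  calc cvar f x n = cvar f x n / 1 := (div_one _).symm
    _ ≤ cvar f x n / (vf (fun i => (x i : ℂ)) n : ℝ≥0∞) :=
        ENNReal.div_le_div_left (by exact_mod_cast h1) _
    _ ≤ _ := h

open MeasureTheory in
/-- A real linear coordinate, bounded on `σ`, has bounded variation. -/
theorem variation_linear_le (a b : ℝ) (hab : a ≠ 0 ∨ b ≠ 0) (R : ℝ)
    (hR : ∀ z ∈ σ, |a * z.re + b * z.im| ≤ R) :
    variation (fun z : σ => ((a * (z : ℂ).re + b * (z : ℂ).im : ℝ) : ℂ)) ≤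
      ENNReal.ofReal (2 * R) := by
  classical
  refine iSup₂_le fun n x => ENNReal.div_le_of_le_mul ?_
  set g : ℕ → ℝ := fun i => a * (x i : ℂ).re + b * (x i : ℂ).im with hg
  have hgR : ∀ i, |g i| ≤ R := fun i => hR _ (x i).2
  -- Crofton's argument: each increment is the measure of the set of levels `c` strictly between its
  -- two values.
  have h1 : ∀ i, ‖((g (i + 1) : ℝ) : ℂ) - ((g i : ℝ) : ℂ)‖ₑ =
      ∫⁻ c in Set.Icc (-R) R, (Set.Ioo (min (g i) (g (i + 1))) (max (g i) (g (i + 1)))).indicator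
        (fun _ => (1 : ℝ≥0∞)) c := by
    intro i
    rw [lintegral_indicator measurableSet_Ioo, setLIntegral_one, Measure.restrict_apply
      measurableSet_Ioo, Set.inter_eq_left.2, Real.volume_Ioo, max_sub_min_eq_abs,
      ← Complex.ofReal_sub, ← ofReal_norm, Complex.norm_real, Real.norm_eq_abs]
    intro c hc
    have h2 := abs_le.1 (hgR i)
    have h3 := abs_le.1 (hgR (i + 1))
    exact ⟨(le_min h2.1 h3.1).trans hc.1.le, hc.2.le.trans (max_le h2.2 h3.2)⟩
  -- Each index counted at level `c` gives a crossing segment of type (i) on the line `a x + b y =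
  -- c`.
  have h2 : ∀ c : ℝ, (∑ i ∈ Finset.range n,
      (Set.Ioo (min (g i) (g (i + 1))) (max (g i) (g (i + 1)))).indicator
        (fun _ => (1 : ℝ≥0∞)) c) ≤ (vf (fun i => (x i : ℂ)) n : ℝ≥0∞) := by
    intro c
    have h3 := vfLine_le_vf (fun i => (x i : ℂ)) n ⟨a, b, c, hab⟩
    refine le_trans ?_ (Nat.cast_le.2 h3)
    simp only [Set.indicator_apply]
    rw [← Finset.sum_filter, Finset.sum_const, nsmul_eq_mul, mul_one, vfLine, Nat.cast_le]
    refine Finset.card_le_card (Finset.monotone_filter_right _ fun i _ hi => Or.inl ?_)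
    change (g i - c) * (g (i + 1) - c) < 0
    obtain ⟨hi1, hi2⟩ := hi
    rcases le_total (g i) (g (i + 1)) with h | h
    · rw [min_eq_left h] at hi1
      rw [max_eq_right h] at hi2
      exact mul_neg_of_neg_of_pos (by linarith) (by linarith)
    · rw [min_eq_right h] at hi1
      rw [max_eq_left h] at hi2
      exact mul_neg_of_pos_of_neg (by linarith) (by linarith)
  calc cvar (fun z : σ => ((a * (z : ℂ).re + b * (z : ℂ).im : ℝ) : ℂ)) x n
      = ∑ i ∈ Finset.range n, ∫⁻ c in Set.Icc (-R) R,
          (Set.Ioo (min (g i) (g (i + 1))) (max (g i) (g (i + 1)))).indicator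
            (fun _ => (1 : ℝ≥0∞)) c := Finset.sum_congr rfl fun i _ => h1 i
    _ = ∫⁻ c in Set.Icc (-R) R, ∑ i ∈ Finset.range n,
          (Set.Ioo (min (g i) (g (i + 1))) (max (g i) (g (i + 1)))).indicator
            (fun _ => (1 : ℝ≥0∞)) c :=
        (lintegral_finsetSum _ fun i _ => measurable_const.indicator measurableSet_Ioo).symm
    _ ≤ ∫⁻ _ in Set.Icc (-R) R, (vf (fun i => (x i : ℂ)) n : ℝ≥0∞) :=
        lintegral_mono fun c => h2 c
    _ = ENNReal.ofReal (2 * R) * (vf (fun i => (x i : ℂ)) n : ℝ≥0∞) := by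
        rw [setLIntegral_const, Real.volume_Icc, mul_comm]
        congr 2
        ring

theorem bvENorm_linear_lt_top (hσ : Bornology.IsBounded σ) (a b : ℝ) (hab : a ≠ 0 ∨ b ≠ 0) :
    bvENorm (fun z : σ => ((a * (z : ℂ).re + b * (z : ℂ).im : ℝ) : ℂ)) < ∞ := by
  obtain ⟨R, hR⟩ := hσ.exists_norm_le
  have hb : ∀ z ∈ σ, |a * z.re + b * z.im| ≤ |a| * R + |b| * R := by
    intro z hz
    refine (abs_add_le _ _).trans ?_
    rw [abs_mul, abs_mul]
    have h1 := (Complex.abs_re_le_norm z).trans (hR z hz)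
    have h2 := (Complex.abs_im_le_norm z).trans (hR z hz)
    gcongr
  refine ENNReal.add_lt_top.2 ⟨?_, (variation_linear_le a b hab _ hb).trans_lt
    ENNReal.ofReal_lt_top⟩
  refine lt_of_le_of_lt (iSup_le fun z => ?_)
    (ENNReal.ofReal_lt_top (r := |a| * R + |b| * R))
  rw [← ofReal_norm, Complex.norm_real, Real.norm_eq_abs]
  exact ENNReal.ofReal_le_ofReal (hb z z.2)

/-! Norm estimates -/

theorem supENorm_pow_le (f : σ → ℂ) (n : ℕ) : supENorm (f ^ n) ≤ supENorm f ^ n := by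
  refine iSup_le fun z => ?_
  rw [Pi.pow_apply, enorm_pow]
  exact pow_le_pow_left' (enorm_le_supENorm f z) n

/-- Leibniz rule; the factor is only linear in the exponent, so it disappears on taking roots. -/
theorem variation_pow_le (f : σ → ℂ) (n : ℕ) :
    variation (f ^ (n + 1)) ≤ (n + 1 : ℕ) * supENorm f ^ n * variation f := by
  induction n with
  | zero => simp
  | succ n ih =>
    rw [pow_succ]
    refine (variation_mul_le _ _).trans ?_
    calc _ ≤ supENorm f ^ (n + 1) * variation f +
          supENorm f * ((n + 1 : ℕ) * supENorm f ^ n * variation f) :=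
          add_le_add (mul_le_mul_left (supENorm_pow_le f (n + 1)) _) (mul_le_mul_right ih _)
      _ = _ := by push_cast; ring

theorem BV.norm_apply_le (f : BV σ) (z : σ) : ‖BV.toFun σ f z‖ ≤ ‖f‖ := by
  rw [BV.norm_def, ← toReal_enorm]
  exact ENNReal.toReal_mono f.bvENorm_ne_top
    ((enorm_le_supENorm _ z).trans le_self_add)

theorem BV.norm_pow_le (f : BV σ) {M : ℝ} (hM : ∀ z, ‖BV.toFun σ f z‖ ≤ M) (hM0 : 0 ≤ M)
    (n : ℕ) : ‖f ^ (n + 1)‖ ≤ M ^ (n + 1) + (n + 1) * M ^ n * ‖f‖ := by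
  have hs : supENorm (BV.toFun σ f) ≤ ENNReal.ofReal M := iSup_le fun z => by
    rw [← ofReal_norm]
    exact ENNReal.ofReal_le_ofReal (hM z)
  have hv : variation (BV.toFun σ f) ≤ ENNReal.ofReal ‖f‖ := by
    rw [BV.norm_def, ENNReal.ofReal_toReal f.bvENorm_ne_top]
    exact le_add_self
  refine ENNReal.toReal_le_of_le_ofReal (by positivity) ?_
  rw [map_pow, ENNReal.ofReal_add (by positivity) (by positivity),
    ENNReal.ofReal_mul (by positivity), ENNReal.ofReal_mul (by positivity),
    ENNReal.ofReal_pow hM0, ENNReal.ofReal_pow hM0]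
  refine add_le_add ((supENorm_pow_le _ _).trans (pow_le_pow_left' hs _))
    ((variation_pow_le _ n).trans ?_)
  refine mul_le_mul' (mul_le_mul' ?_ (pow_le_pow_left' hs _)) hv
  rw [← Nat.cast_succ, ENNReal.ofReal_natCast]

/-! Point evaluations and coordinates -/

/-- Evaluation at a point of `σ`. -/
def AC.eval (z : σ) : AC σ →ₐ[ℂ] ℂ :=
  ((Pi.evalAlgHom ℂ (fun _ : σ => ℂ) z).comp (BV.toFun σ)).comp (AC σ).val

theorem AC.norm_eval_le (z : σ) (f : AC σ) : ‖AC.eval z f‖ ≤ ‖f‖ :=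
  BV.norm_apply_le (f : BV σ) z

theorem AC.continuous_eval (z : σ) : Continuous (AC.eval z) :=
  (AC.eval z).toLinearMap.mkContinuous 1 (fun f => by
    rw [one_mul]; exact AC.norm_eval_le z f) |>.continuous

theorem AC.ext_eval {f g : AC σ} (h : ∀ z, AC.eval z f = AC.eval z g) : f = g :=
  Subtype.ext (BV.toFun_injective σ (funext h))

theorem exists_coordinates (hσ : Bornology.IsBounded σ) :
    ∃ X Y : BV σ, BV.toFun σ X = (fun z : σ => ((z : ℂ).re : ℂ)) ∧
      BV.toFun σ Y = (fun z : σ => ((z : ℂ).im : ℂ)) := by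
  have hX := bvENorm_linear_lt_top hσ 1 0 (Or.inl one_ne_zero)
  have hY := bvENorm_linear_lt_top hσ 0 1 (Or.inr one_ne_zero)
  simp only [one_mul, zero_mul, add_zero, zero_add] at hX hY
  exact ⟨(⟨_, hX⟩ : bvSubalgebra σ), (⟨_, hY⟩ : bvSubalgebra σ), rfl, rfl⟩

/-- Boundedness puts both coordinates in `BV`, so the polynomial functions are exactly the
polynomials in `X` and `Y`. Continuous characters are then determined by two values. -/
theorem exists_coordinates_AC (hσ : Bornology.IsBounded σ) :
    ∃ X Y : AC σ, (∀ z, AC.eval z X = ((z : ℂ).re : ℂ)) ∧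
      (∀ z, AC.eval z Y = ((z : ℂ).im : ℂ)) ∧
      Dense (Set.range (MvPolynomial.aeval (R := ℂ) ![X, Y])) := by
  obtain ⟨X, Y, hX, hY⟩ := exists_coordinates hσ
  have hXY : ∀ p : MvPolynomial (Fin 2) ℂ, BV.toFun σ (MvPolynomial.aeval ![X, Y] p) =
      MvPolynomial.aeval (R := ℂ)
        ![fun z : σ => ((z : ℂ).re : ℂ), fun z : σ => ((z : ℂ).im : ℂ)] p := by
    intro p
    rw [← AlgHom.comp_apply]
    congr 1
    ext i : 1
    fin_cases i
    · simpa using hX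
    · simpa using hY
  have hmem : ∀ p : MvPolynomial (Fin 2) ℂ, MvPolynomial.aeval ![X, Y] p ∈ AC σ := by
    intro p
    refine Subalgebra.le_topologicalClosure _ ?_
    exact ⟨p, (hXY p).symm⟩
  have hXm : X ∈ AC σ := by simpa using hmem (MvPolynomial.X 0)
  have hYm : Y ∈ AC σ := by simpa using hmem (MvPolynomial.X 1)
  refine ⟨⟨X, hXm⟩, ⟨Y, hYm⟩, fun z => congrFun hX z, fun z => congrFun hY z, ?_⟩
  have hval : ∀ p : MvPolynomial (Fin 2) ℂ,
      ((MvPolynomial.aeval ![(⟨X, hXm⟩ : AC σ), ⟨Y, hYm⟩] p : AC σ) : BV σ) =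
        MvPolynomial.aeval ![X, Y] p := by
    intro p
    rw [← Subalgebra.coe_val, ← AlgHom.comp_apply]
    congr 1
    ext i : 1
    fin_cases i <;> simp
  intro f
  rw [Metric.mem_closure_iff]
  intro ε hε
  have hf : (f : BV σ) ∈ closure (((polyFun σ).comap (BV.toFun σ) : Subalgebra ℂ (BV σ)) :
      Set (BV σ)) := f.2
  obtain ⟨g, hg, hfg⟩ := Metric.mem_closure_iff.1 hf ε hε
  obtain ⟨p, hp⟩ : BV.toFun σ g ∈ polyFun σ := hg
  refine ⟨_, ⟨p, rfl⟩, ?_⟩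
  rw [Subtype.dist_eq, hval]
  rwa [BV.toFun_injective σ ((hXY p).trans hp)]

/-- The variation norm dominates the supremum norm, so elements of `AC` are uniform limits of
polynomials. -/
theorem AC.continuous_apply (hσ : Bornology.IsBounded σ) (f : AC σ) :
    Continuous fun z => AC.eval z f := by
  obtain ⟨X, Y, hX, hY, hd⟩ := exists_coordinates_AC hσ
  refine continuous_of_uniform_approx_of_continuous fun u hu => ?_
  obtain ⟨ε, hε, hεu⟩ := Metric.mem_uniformity_dist.1 hu
  obtain ⟨_, ⟨p, rfl⟩, hp⟩ := hd.exists_dist_lt f hε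
  refine ⟨fun z => AC.eval z (MvPolynomial.aeval ![X, Y] p), ?_, fun z => hεu ?_⟩
  · have h : ∀ z : σ, AC.eval z (MvPolynomial.aeval ![X, Y] p) =
        MvPolynomial.eval ![((z : ℂ).re : ℂ), ((z : ℂ).im : ℂ)] p := by
      intro z
      rw [← AlgHom.comp_apply, ← MvPolynomial.coe_aeval_eq_eval, RingHom.coe_coe]
      congr 1
      ext i : 1
      fin_cases i
      · simpa using hX z
      · simpa using hY z
    simp only [h]
    refine (MvPolynomial.continuous_eval p).comp (continuous_pi fun i => ?_)
    fin_cases i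
    · exact Complex.continuous_ofReal.comp (Complex.continuous_re.comp continuous_subtype_val)
    · exact Complex.continuous_ofReal.comp (Complex.continuous_im.comp continuous_subtype_val)
  · rw [dist_eq_norm, ← map_sub]
    exact (AC.norm_eval_le z _).trans_lt (by rwa [← dist_eq_norm])

/-! Characters -/

/-- Stated for any character, to serve both for point evaluations and for an unknown `φ`. -/
theorem algHom_one_sub_mul_sq {A : Type*} [CommRing A] [Algebra ℂ A] (φ : A →ₐ[ℂ] ℂ) (x : A)
    (c a : ℂ) : φ (1 - algebraMap ℂ A c * (x - algebraMap ℂ A a) ^ 2) =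
      1 - c * (φ x - a) ^ 2 := by
  simp

theorem algHom_one_sub_mul_add_sq {A : Type*} [CommRing A] [Algebra ℂ A] (φ : A →ₐ[ℂ] ℂ)
    (x y : A) (c a b : ℂ) :
    φ (1 - algebraMap ℂ A c * ((x - algebraMap ℂ A a) ^ 2 + (y - algebraMap ℂ A b) ^ 2)) =
      1 - c * ((φ x - a) ^ 2 + (φ y - b) ^ 2) := by
  simp

/-- Continuous characters of `AC(σ)` are bounded by the supremum norm. -/
theorem norm_character_le (φ : AC σ →ₐ[ℂ] ℂ) (hφ : Continuous φ) (f : AC σ) {M : ℝ}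
    (hM : ∀ z, ‖AC.eval z f‖ ≤ M) (hM0 : 0 ≤ M) : ‖φ f‖ ≤ M := by
  let L : AC σ →L[ℂ] ℂ := ⟨φ.toLinearMap, hφ⟩
  have hL : ∀ g, ‖φ g‖ ≤ ‖L‖ * ‖g‖ := fun g => L.le_opNorm g
  by_contra! h
  have hw : 0 < ‖φ f‖ := hM0.trans_lt h
  set r := M / ‖φ f‖ with hr
  have hr0 : 0 ≤ r := div_nonneg hM0 hw.le
  have hr1 : r < 1 := (div_lt_one hw).2 h
  have hMr : M = r * ‖φ f‖ := by rw [hr]; field_simp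
  -- Spectral radius argument: bound `φ (f ^ (n + 1))` by `‖L‖ * ‖f ^ (n + 1)‖` and divide by `‖φ f‖
  -- ^ (n + 1)`. The right side tends to 0 because `r < 1`.
  have key : ∀ n : ℕ, 1 ≤ ‖L‖ * (r ^ (n + 1) + (n * r ^ n + r ^ n) * (‖f‖ / ‖φ f‖)) := by
    intro n
    have h1 := hL (f ^ (n + 1))
    have h2 : ‖f ^ (n + 1)‖ ≤ M ^ (n + 1) + (n + 1) * M ^ n * ‖f‖ :=
      BV.norm_pow_le (f : BV σ) hM hM0 n
    rw [map_pow, norm_pow] at h1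
    have h3 := h1.trans (mul_le_mul_of_nonneg_left h2 (norm_nonneg L))
    have h4 : ‖L‖ * (M ^ (n + 1) + (n + 1) * M ^ n * ‖f‖) =
        (‖L‖ * (r ^ (n + 1) + (n * r ^ n + r ^ n) * (‖f‖ / ‖φ f‖))) * ‖φ f‖ ^ (n + 1) := by
      rw [hMr, mul_pow, mul_pow]; field_simp; ring
    rw [h4] at h3
    exact (le_mul_iff_one_le_left (pow_pos hw _)).1 h3
  have hlim : Filter.Tendsto
      (fun n : ℕ => ‖L‖ * (r ^ (n + 1) + (n * r ^ n + r ^ n) * (‖f‖ / ‖φ f‖)))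
      Filter.atTop (nhds (‖L‖ * (0 + (0 + 0) * (‖f‖ / ‖φ f‖)))) := by
    have t1 := tendsto_pow_atTop_nhds_zero_of_lt_one hr0 hr1
    have t2 := tendsto_self_mul_const_pow_of_lt_one hr0 hr1
    exact (((Filter.tendsto_add_atTop_iff_nat 1).2 t1).add
      ((t2.add t1).mul_const _)).const_mul _
  have := ge_of_tendsto' hlim key
  simp at this
  linarith

/-- A character takes real values on real functions. -/
theorem character_im_eq_zero (φ : AC σ →ₐ[ℂ] ℂ) (hφ : Continuous φ) (f : AC σ) (g : σ → ℝ)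
    (hg : ∀ z, AC.eval z f = (g z : ℂ)) : (φ f).im = 0 := by
  by_contra hb
  set α := (φ f).re
  set β := (φ f).im
  -- With `R ≥ (g z - α) ^ 2` the function `F` takes values in `[0, 1]`, whereas `φ f - α = β * I`
  -- makes `φ F = 1 + β ^ 2 / R > 1`.
  let R : ℝ := (‖f‖ + |α|) ^ 2 + 1
  have hR : 0 < R := by positivity
  let F : AC σ := 1 - algebraMap ℂ _ ((1 / R : ℝ) : ℂ) * (f - algebraMap ℂ _ (α : ℂ)) ^ 2
  have hF : ‖φ F‖ ≤ 1 := by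
    refine norm_character_le φ hφ F (fun z => ?_) zero_le_one
    have h1 : AC.eval z F = ((1 - 1 / R * (g z - α) ^ 2 : ℝ) : ℂ) := by
      refine (algHom_one_sub_mul_sq _ f _ _).trans ?_
      rw [hg]
      push_cast
      rfl
    have h2 : |g z - α| ≤ ‖f‖ + |α| := by
      refine (abs_sub _ _).trans (add_le_add_left ?_ _)
      have := AC.norm_eval_le z f
      rwa [hg, Complex.norm_real, Real.norm_eq_abs] at this
    have h3 : (g z - α) ^ 2 ≤ R := by
      have := pow_le_pow_left₀ (abs_nonneg _) h2 2
      rw [sq_abs] at this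
      linarith
    have h4 : 1 / R * (g z - α) ^ 2 ≤ 1 := by
      rw [one_div, inv_mul_le_iff₀ hR]; linarith
    have h5 : 0 ≤ 1 / R * (g z - α) ^ 2 := by positivity
    rw [h1, Complex.norm_real, Real.norm_eq_abs, abs_le]
    constructor <;> linarith
  have h6 : φ F = ((1 + 1 / R * β ^ 2 : ℝ) : ℂ) := by
    have h7 : φ f - α = β * Complex.I := by
      rw [← Complex.re_add_im (φ f)]; ring
    refine (algHom_one_sub_mul_sq φ f _ _).trans ?_
    rw [h7, mul_pow, Complex.I_sq]
    push_cast
    ring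
  have h8 : 0 < 1 / R * β ^ 2 := by positivity
  rw [h6, Complex.norm_real, Real.norm_eq_abs, abs_of_pos (by linarith)] at hF
  linarith

/-- On a compact set, the continuous characters of `AC(σ)` are the point evaluations. -/
theorem exists_eq_eval (hσ : IsCompact σ) (φ : AC σ →ₐ[ℂ] ℂ) (hφ : Continuous φ) :
    ∃ z : σ, φ = AC.eval z := by
  obtain ⟨X, Y, hX, hY, hd⟩ := exists_coordinates_AC hσ.isBounded
  have ha := character_im_eq_zero φ hφ X _ hX
  have hb := character_im_eq_zero φ hφ Y _ hY
  set w : ℂ := ⟨(φ X).re, (φ Y).re⟩ with hw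
  have hXw : φ X = (w.re : ℂ) := Complex.ext rfl (by simpa using ha)
  have hYw : φ Y = (w.im : ℂ) := Complex.ext rfl (by simpa using hb)
  have hwσ : w ∈ σ := by
    by_contra hwn
    obtain ⟨δ, hδ, hball⟩ := Metric.isOpen_iff.1 hσ.isClosed.isOpen_compl w hwn
    have hdist : ∀ z ∈ σ, δ ≤ ‖z - w‖ := by
      intro z hz
      by_contra! h
      exact hball (by rwa [Metric.mem_ball, dist_eq_norm]) hz
    obtain ⟨C, hC⟩ := hσ.isBounded.exists_norm_le
    -- `R` bounds both `‖z - w‖ ^ 2` and `δ ^ 2`, so on `σ` the function `F = 1 - ‖z - w‖ ^ 2 / R`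
    -- lies between 0 and `1 - δ ^ 2 / R`, while `φ F = 1`.
    let R : ℝ := (|C| + ‖w‖) ^ 2 + δ ^ 2
    have hR : 0 < R := by positivity
    let F : AC σ := 1 - algebraMap ℂ _ ((1 / R : ℝ) : ℂ) *
      ((X - algebraMap ℂ _ (w.re : ℂ)) ^ 2 + (Y - algebraMap ℂ _ (w.im : ℂ)) ^ 2)
    have hδR : δ ^ 2 / R ≤ 1 := by
      rw [div_le_one hR]; simp only [R]; nlinarith [sq_nonneg (|C| + ‖w‖)]
    have hF : ‖φ F‖ ≤ 1 - δ ^ 2 / R := by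
      refine norm_character_le φ hφ F (fun z => ?_) (by linarith)
      have h1 : AC.eval z F = ((1 - ‖(z : ℂ) - w‖ ^ 2 / R : ℝ) : ℂ) := by
        rw [Complex.sq_norm, Complex.normSq_apply]
        refine (algHom_one_sub_mul_add_sq _ X Y _ _ _).trans ?_
        rw [hX, hY, Complex.sub_re, Complex.sub_im]
        push_cast
        ring
      have h2 : ‖(z : ℂ) - w‖ ≤ |C| + ‖w‖ :=
        (norm_sub_le _ _).trans (by gcongr; exact (hC z z.2).trans (le_abs_self C))
      have h3 : ‖(z : ℂ) - w‖ ^ 2 / R ≤ 1 := by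
        rw [div_le_one hR]
        have := pow_le_pow_left₀ (norm_nonneg _) h2 2
        simp only [R]
        nlinarith [sq_nonneg δ]
      have h4 : δ ^ 2 / R ≤ ‖(z : ℂ) - w‖ ^ 2 / R := by
        gcongr
        exact hdist z z.2
      rw [h1, Complex.norm_real, Real.norm_eq_abs, abs_of_nonneg (by linarith)]
      linarith
    have h6 : φ F = 1 := by
      refine (algHom_one_sub_mul_add_sq φ X Y _ _ _).trans ?_
      rw [hXw, hYw]
      simp
    have h7 : 0 < δ ^ 2 / R := by positivity
    rw [h6, norm_one] at hF
    linarith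
  refine ⟨⟨w, hwσ⟩, ?_⟩
  refine DFunLike.coe_injective (Continuous.ext_on hd hφ (AC.continuous_eval _) ?_)
  rintro _ ⟨p, rfl⟩
  rw [← AlgHom.comp_apply, ← AlgHom.comp_apply]
  congr 1
  ext i : 1
  fin_cases i
  · simpa [hX] using hXw
  · simpa [hY] using hYw

/-! The segment and the oscillating curve -/

/-- The function `t sin (1/t)`, with value `0` at `0`. -/
def osc (t : ℝ) : ℝ := t * Real.sin (1 / t)

theorem continuous_osc : Continuous osc := by
  rw [continuous_iff_continuousAt]
  intro t
  rcases eq_or_ne t 0 with rfl | ht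
  · have h0 : osc 0 = 0 := by simp [osc]
    rw [ContinuousAt, h0]
    refine squeeze_zero_norm (a := fun t : ℝ => ‖t‖) (fun t => ?_)
      (by simpa using (continuous_norm (E := ℝ)).tendsto 0)
    rw [osc, norm_mul]
    exact mul_le_of_le_one_right (norm_nonneg _) (Real.abs_sin_le_one _)
  · exact continuousAt_id.mul
      (Real.continuous_sin.continuousAt.comp (continuousAt_const.div continuousAt_id ht))

theorem mem_sineCurve {z : ℂ} : z ∈ sineCurve ↔ (0 ≤ z.re ∧ z.re ≤ 1) ∧ z.im = osc z.re := by
  constructor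
  · rintro (rfl | ⟨t, h0, h1, rfl⟩)
    · simp [osc]
    · exact ⟨⟨h0.le, h1⟩, rfl⟩
  · rintro ⟨⟨h0, h1⟩, h⟩
    rcases h0.eq_or_lt with h2 | h2
    · left
      rw [← h2] at h
      exact Complex.ext h2.symm (by simpa [osc] using h)
    · exact Or.inr ⟨z.re, h2, h1, Complex.ext rfl h⟩

theorem mem_unitSegment {z : ℂ} : z ∈ unitSegment ↔ (0 ≤ z.re ∧ z.re ≤ 1) ∧ z.im = 0 := by
  constructor
  · rintro ⟨t, h0, h1, rfl⟩
    exact ⟨⟨h0, h1⟩, rfl⟩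
  · rintro ⟨⟨h0, h1⟩, h⟩
    exact ⟨z.re, h0, h1, Complex.ext rfl h⟩

theorem unitSegment_eq_segment : unitSegment = segment ℝ (0 : ℂ) 1 := by
  ext z
  rw [mem_unitSegment, segment_eq_image]
  constructor
  · rintro ⟨h, him⟩
    exact ⟨z.re, h, Complex.ext (by simp) (by simp [him])⟩
  · rintro ⟨t, ⟨h0, h1⟩, rfl⟩
    simp [h0, h1]

theorem isLinearGraph_unitSegment : IsLinearGraph unitSegment := by
  rw [unitSegment_eq_segment]
  refine ⟨?_, ⟨⟨0, left_mem_segment ℝ _ _⟩, (convex_segment _ _).isPreconnected⟩,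
    1, fun _ => 0, fun _ => 1, fun _ => zero_ne_one, ?_⟩
  · rw [segment_eq_image]
    exact isCompact_Icc.image (by fun_prop)
  · rw [Set.iUnion_const]

/-- The vertical projection is a homeomorphism between the graph of `t sin (1/t)` and the
segment. -/
def segmentHomeoSineCurve : unitSegment ≃ₜ sineCurve where
  toFun z := ⟨⟨(z : ℂ).re, osc (z : ℂ).re⟩, mem_sineCurve.2 ⟨(mem_unitSegment.1 z.2).1, rfl⟩⟩
  invFun z := ⟨⟨(z : ℂ).re, 0⟩, mem_unitSegment.2 ⟨(mem_sineCurve.1 z.2).1, rfl⟩⟩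
  left_inv z := Subtype.ext (Complex.ext rfl (mem_unitSegment.1 z.2).2.symm)
  right_inv z := Subtype.ext (Complex.ext rfl (mem_sineCurve.1 z.2).2.symm)
  continuous_toFun := by
    refine Continuous.subtype_mk ?_ _
    have h : Continuous fun z : unitSegment => (z : ℂ).re :=
      Complex.continuous_re.comp continuous_subtype_val
    exact Complex.equivRealProdCLM.symm.continuous.comp (h.prodMk (continuous_osc.comp h))
  continuous_invFun := by
    refine Continuous.subtype_mk ?_ _
    have h : Continuous fun z : sineCurve => (z : ℂ).re :=
      Complex.continuous_re.comp continuous_subtype_val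
    exact Complex.equivRealProdCLM.symm.continuous.comp (h.prodMk continuous_const)

theorem isCompact_sineCurve : IsCompact sineCurve := by
  have := isCompact_iff_compactSpace.1 isLinearGraph_unitSegment.1
  exact isCompact_iff_compactSpace.2 segmentHomeoSineCurve.compactSpace

/-! Infinite variation of `t sin (1/t)` -/

/-- The abscissae of the extreme values of `sin (1/t)`. -/
def peak (k : ℕ) : ℝ := 1 / (Real.pi / 2 + k * Real.pi)

theorem peak_pos (k : ℕ) : 0 < peak k := by
  have := Real.pi_pos
  unfold peak
  positivity

theorem peak_strictAnti : StrictAnti peak := by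
  intro i j hij
  have := Real.pi_pos
  have h : (i : ℝ) < j := Nat.cast_lt.2 hij
  unfold peak
  gcongr

theorem osc_peak (k : ℕ) : osc (peak k) = peak k * (-1) ^ k := by
  rw [osc, peak, one_div_one_div, Real.sin_add_nat_mul_pi, Real.sin_pi_div_two, mul_one]

/-- Consecutive extreme values have opposite signs, so their heights add. -/
theorem peak_le_abs_osc_sub (k : ℕ) : peak k ≤ |osc (peak (k + 1)) - osc (peak k)| := by
  have h : osc (peak (k + 1)) - osc (peak k) = -((-1) ^ k * (peak (k + 1) + peak k)) := by
    rw [osc_peak, osc_peak, pow_succ]; ring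
  rw [h, abs_neg, abs_mul, abs_pow, abs_neg, abs_one, one_pow, one_mul,
    abs_of_pos (add_pos (peak_pos _) (peak_pos _))]
  exact le_add_of_nonneg_left (peak_pos _).le

theorem one_div_le_peak (k : ℕ) : 1 / Real.pi * (1 / ((k + 1 : ℕ) : ℝ)) ≤ peak k := by
  have := Real.pi_pos
  rw [peak, one_div_mul_one_div_rev]
  refine one_div_le_one_div_of_le (by positivity) ?_
  push_cast
  nlinarith

/-- Comparison with the harmonic series; the shift is needed because only peaks below the value `p
b` are sure to be attained. -/
theorem not_summable_peak_add (N : ℕ) : ¬ Summable fun k => peak (k + N) := by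
  rw [summable_nat_add_iff]
  intro h
  have h1 : Summable fun k : ℕ => 1 / Real.pi * (1 / ((k + 1 : ℕ) : ℝ)) :=
    Summable.of_nonneg_of_le (fun k => by have := Real.pi_pos; positivity) one_div_le_peak h
  rw [summable_mul_left_iff (by have := Real.pi_pos; positivity)] at h1
  exact Real.not_summable_one_div_natCast
    ((summable_nat_add_iff (f := fun n : ℕ => 1 / (n : ℝ)) 1).1 h1)

theorem tendsto_peak : Filter.Tendsto peak Filter.atTop (nhds 0) := by
  have := Real.pi_pos
  refine Filter.Tendsto.div_atTop tendsto_const_nhds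
    (Filter.tendsto_atTop_add_const_left _ _
      (tendsto_natCast_atTop_atTop.atTop_mul_const this))

/-- First hitting points of a decreasing sequence of values. -/
theorem exists_strictAnti_preimages (P : ℝ → ℝ) (hP : ContinuousOn P (Set.Icc 0 1))
    (h0 : P 0 = 0) (t : ℕ → ℝ) (ht : StrictAnti t) (ht0 : ∀ k, 0 ≤ t k) (h1 : ∀ k, t k ≤ P 1) :
    ∃ r : ℕ → ℝ, StrictAnti r ∧ ∀ k, r k ∈ Set.Icc (0 : ℝ) 1 ∧ P (r k) = t k := by
  -- Least preimages come out ordered: `P` already takes the smaller value `t (k + 1)` between 0 and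
  -- `r k`.
  have hit : ∀ k, ∃ r, IsLeast {r | r ∈ Set.Icc (0 : ℝ) 1 ∧ P r = t k} r := by
    intro k
    refine IsCompact.exists_isLeast ?_ ?_
    · exact isCompact_Icc.of_isClosed_subset
        (hP.preimage_isClosed_of_isClosed isClosed_Icc isClosed_singleton) fun r hr => hr.1
    · exact intermediate_value_Icc zero_le_one hP ⟨h0.le.trans (ht0 k), h1 k⟩
  choose r hr using hit
  refine ⟨r, strictAnti_nat_of_succ_lt fun k => ?_, fun k => (hr k).1⟩
  obtain ⟨⟨hrk, hPk⟩, -⟩ := hr k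
  have hcont : ContinuousOn P (Set.Icc 0 (r k)) := hP.mono (Set.Icc_subset_Icc_right hrk.2)
  obtain ⟨s, hs, hPs⟩ := intermediate_value_Icc hrk.1 hcont
    (show t (k + 1) ∈ Set.Icc (P 0) (P (r k)) from
      ⟨h0.le.trans (ht0 _), hPk ▸ (ht (Nat.lt_succ_self k)).le⟩)
  have hle : r (k + 1) ≤ s := (hr (k + 1)).2 ⟨⟨hs.1, hs.2.trans hrk.2⟩, hPs⟩
  refine lt_of_le_of_ne (hle.trans hs.2) fun heq => ?_
  have := (hr (k + 1)).1.2
  rw [heq, hPk] at this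
  exact (ht (Nat.lt_succ_self k)).ne' this

/-- On a convex set, if a continuous function `p ≥ 0` has a zero and is not identically zero,
then `t sin (1/t)` composed with `p` has infinite variation. -/
theorem variation_osc_comp_eq_top {σ : Set ℂ} (hσ : Convex ℝ σ) (p : σ → ℝ)
    (hp : Continuous p) (a b : σ) (ha : p a = 0) (hb : 0 < p b) :
    variation (fun z => (osc (p z) : ℂ)) = ∞ := by
  let γ : ℝ → ℂ := fun r => (a : ℂ) + (r : ℂ) * ((b : ℂ) - a)
  have hγ : ∀ r ∈ Set.Icc (0 : ℝ) 1, γ r ∈ σ := by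
    intro r hr
    have := hσ.add_smul_sub_mem a.2 b.2 hr
    simpa [γ] using this
  let P : ℝ → ℝ := Set.IccExtend zero_le_one fun r : Set.Icc (0 : ℝ) 1 => p ⟨γ r, hγ r r.2⟩
  have hP : ∀ (r : ℝ) (hr : r ∈ Set.Icc (0 : ℝ) 1), P r = p ⟨γ r, hγ r hr⟩ := fun r hr =>
    Set.IccExtend_of_mem _ _ hr
  have hPc : Continuous P := by
    refine Continuous.Icc_extend' (hp.comp (Continuous.subtype_mk ?_ _))
    simp only [γ]
    fun_prop
  have hP0 : P 0 = 0 := by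
    refine (hP 0 (by simp)).trans (Eq.trans ?_ ha)
    congr 1
    exact Subtype.ext (by simp [γ])
  have hP1 : P 1 = p b := by
    rw [hP 1 (by simp)]
    congr 1
    exact Subtype.ext (by simp [γ])
  -- Discard the peaks at or above `p b = P 1`, so that the intermediate value theorem reaches all
  -- the others.
  obtain ⟨N, hN⟩ := (tendsto_peak.eventually (gt_mem_nhds hb)).exists
  obtain ⟨r, hr, hrP⟩ := exists_strictAnti_preimages P hPc.continuousOn hP0
    (fun k => peak (k + N)) (fun i j hij => peak_strictAnti (Nat.add_lt_add_right hij N))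
    (fun k => (peak_pos _).le) (fun k => by
      rw [hP1]
      exact (peak_strictAnti.antitone (Nat.le_add_left N k)).trans hN.le)
  let x : ℕ → σ := fun k => ⟨γ (r k), hγ _ (hrP k).1⟩
  have hx : ∀ k, p (x k) = peak (k + N) := fun k => by
    rw [← (hrP k).2, hP _ (hrP k).1]
  by_contra hv
  refine not_summable_peak_add N (summable_of_sum_range_le
    (c := (variation fun z => (osc (p z) : ℂ)).toReal) (fun k => (peak_pos _).le) fun n => ?_)
  have h1 := cvar_le_variation_of_strictAnti (fun z => (osc (p z) : ℂ)) x a (b - a) r hr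
    (fun i => rfl) n
  rw [← ENNReal.ofReal_le_iff_le_toReal hv]
  refine le_trans ?_ h1
  rw [ENNReal.ofReal_sum_of_nonneg fun k _ => (peak_pos _).le, cvar]
  refine Finset.sum_le_sum fun k _ => ?_
  rw [hx, hx, ← Complex.ofReal_sub, ← ofReal_norm, Complex.norm_real, Real.norm_eq_abs]
  refine ENNReal.ofReal_le_ofReal ?_
  have := peak_le_abs_osc_sub (k + N)
  rwa [Nat.add_right_comm] at this

/-! ### Transport of the coordinates by an isomorphism -/

theorem not_ACIsomorphic : ¬ ACIsomorphic unitSegment sineCurve := by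
  rintro ⟨Ψ⟩
  have hσ : IsCompact unitSegment := isLinearGraph_unitSegment.1
  have hτ := isCompact_sineCurve
  obtain ⟨X, Y, hX, hY, -⟩ := exists_coordinates_AC hτ.isBounded
  have hpt : ∀ s : unitSegment, ∃ z : sineCurve, ∀ f, AC.eval s (Ψ.symm f) = AC.eval z f := by
    intro s
    obtain ⟨z, hz⟩ := exists_eq_eval hτ
      ((AC.eval s).comp (Ψ.symm.toAlgEquiv : AC sineCurve →ₐ[ℂ] AC unitSegment))
      ((AC.continuous_eval s).comp Ψ.symm.continuous)
    exact ⟨z, fun f => DFunLike.congr_fun hz f⟩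
  choose h hh using hpt
  set p : unitSegment → ℝ := fun s => (h s : ℂ).re with hp
  have hpX : ∀ s, AC.eval s (Ψ.symm X) = (p s : ℂ) := fun s => (hh s X).trans (hX _)
  have hpY : ∀ s, AC.eval s (Ψ.symm Y) = (osc (p s) : ℂ) := fun s => by
    rw [hh, hY, (mem_sineCurve.1 (h s).2).2]
  have hpc : Continuous p := by
    have := Complex.continuous_re.comp (AC.continuous_apply hσ.isBounded (Ψ.symm X))
    simpa [Function.comp_def, hpX] using this
  -- The evaluation at the origin, pulled back by `Ψ`, is the evaluation at some `a`; apply it to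
  -- `Ψ.symm X`.
  obtain ⟨a, ha⟩ : ∃ a, p a = 0 := by
    let o : sineCurve := ⟨0, Or.inl rfl⟩
    obtain ⟨a, ha⟩ := exists_eq_eval hσ
      ((AC.eval o).comp (Ψ.toAlgEquiv : AC unitSegment →ₐ[ℂ] AC sineCurve))
      ((AC.continuous_eval o).comp Ψ.continuous)
    refine ⟨a, ?_⟩
    have h1 : AC.eval o (Ψ (Ψ.symm X)) = AC.eval a (Ψ.symm X) :=
      DFunLike.congr_fun ha (Ψ.symm X)
    rw [Ψ.apply_symm_apply, hX, hpX] at h1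
    simpa [o] using h1.symm
  -- Otherwise `p` vanishes identically, since abscissae on the curve are nonnegative; then `X = 0`,
  -- but `X` is 1 at the right endpoint.
  obtain ⟨b, hb⟩ : ∃ b, 0 < p b := by
    by_contra! hle
    have h0 : Ψ.symm X = 0 := AC.ext_eval fun s => by
      rw [hpX, le_antisymm (hle s) (mem_sineCurve.1 (h s).2).1.1]
      simp
    have hX0 : X = 0 := by simpa using h0
    have h1 := hX ⟨⟨1, osc 1⟩, mem_sineCurve.2 ⟨by simp, rfl⟩⟩
    rw [hX0, map_zero] at h1
    simp at h1
  have hconv : Convex ℝ unitSegment := by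
    rw [unitSegment_eq_segment]
    exact convex_segment _ _
  have htop := variation_osc_comp_eq_top hconv p hpc a b ha hb
  have hY' : BV.toFun unitSegment (Ψ.symm Y : BV unitSegment) = fun s => (osc (p s) : ℂ) :=
    funext hpY
  refine BV.bvENorm_ne_top (Ψ.symm Y : BV unitSegment) ?_
  rw [hY', bvENorm, htop, add_top]

end PlaneAC

end

theorem mainTheorem7 :
    PlaneAC.IsLinearGraph PlaneAC.unitSegment ∧
    Nonempty (PlaneAC.unitSegment ≃ₜ PlaneAC.sineCurve) ∧
    ¬ PlaneAC.ACIsomorphic PlaneAC.unitSegment PlaneAC.sineCurve ∧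
    ¬ (∀ σ τ : Set ℂ,
        (∃ σ' : Set ℂ, PlaneAC.IsLinearGraph σ' ∧ Nonempty (σ ≃ₜ σ')) →
        (∃ τ' : Set ℂ, PlaneAC.IsLinearGraph τ' ∧ Nonempty (τ ≃ₜ τ')) →
        (PlaneAC.ACIsomorphic σ τ ↔ Nonempty (σ ≃ₜ τ))) := by
  have h : PlaneAC.unitSegment ≃ₜ PlaneAC.sineCurve := PlaneAC.segmentHomeoSineCurve
  have hL := PlaneAC.isLinearGraph_unitSegment
  exact ⟨hL, ⟨h⟩, PlaneAC.not_ACIsomorphic, fun H => PlaneAC.not_ACIsomorphic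
    ((H _ _ ⟨_, hL, ⟨Homeomorph.refl _⟩⟩ ⟨_, hL, ⟨h.symm⟩⟩).2 ⟨h⟩)⟩
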